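/- **Conventions.** Let $V$ be a Euclidean space of dimension $n$ with orthonormal basis $e_1,\dots,e_n$. A *curvature operator* $R$ on $V$ is a symmetric operator on the $\binom n2$-dimensional space of 2-forms $\Lambda^2$, that is, a 4-linear form $R(a,b,c,d)$ on $V$ with $R(b,a,c,d)=-R(a,b,c,d)$ and $R(c,d,a,b)=R(a,b,c,d)$; every Riemann curvature tensor is one (the first Bianchi identity is not needed). Such an $R$, and likewise every 4-form $K$, is identified with its matrix $\big(R(e_i,e_j,e_k,e_l)\big)_{i<j,\;k<l}$, respectively $\big(K(e_i,e_j,e_k,e_l)\big)_{i<j,\;k<l}$, in the orthonormal basis $(e_i\wedge e_j)_{i<j}$ of $\Lambda^2$. $I$ is the identity. For polynomials in $m$ variables $z=(z_1,\dots,z_m)$, the *degree-$d$ discriminant* $\Delta_{m,d}$ is the equation, with coprime integer coefficients, of the Zariski closure of the set of complex polynomials $f$ of degree at most $d$ that have a multiple root, i.e. a point $y\in\mathbb C^m$ with $f(y)=\partial_{z_1}f(y)=\dots=\partial_{z_m}f(y)=0$. Precisely, $\Delta_{m,d}$ is the greatest common divisor of all integer polynomials in the coefficients of the generic polynomial of degree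 at most $d$ that vanish at all such $f$; it is an integer polynomial in these coefficients, defined up to sign. For a polynomial $p$ of degree at most $d$ in $z$ with coefficients in a commutative ring, $\mathrm{disc}_{z,d}(p)$ is the value of $\Delta_{m,d}$ at the coefficients of $p$. **Theorem.** Let $n\ge 5$, let $R$ be a curvature operator on $V$, and let $K_1,\dots,K_{\binom n4}$ be a basis of the space of 4-forms on $V$. Put $$p(x,z_1,\dots,z_{\binom n4})=\det\Big(R-xI-\sum_{s=1}^{\binom n4} z_sK_s\Big),$$ regarded as a polynomial in $z$ with coefficients in $\mathbb R[x]$. Let $d$ be the degree of $p$ in $z$, or any larger integer, and let $q(x)=\mathrm{disc}_{z,d}(p)\in\mathbb R[x]$ be its multivariate discriminant with respect to the $z$ variables. Then $q$ is the zero polynomial. -/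

import Mathlib

open scoped Polynomial

noncomputable section

/-! ### The multivariate discriminant -/

/-- Exponents of the monomials of degree at most `d` in the variables `σ`.  They index the
coefficients of the generic polynomial of degree at most `d` in these variables. -/
abbrev DegLE (σ : Type*) (d : ℕ) : Type _ := {a : σ →₀ ℕ // a.degree ≤ d}

/-- The value at the coefficients of `f` of an integer polynomial `G` in the coefficients of the
generic polynomial of degree at most `d`. -/
def evalCoeffs {σ A : Type*} [CommRing A] {d : ℕ}
    (G : MvPolynomial (DegLE σ d) ℤ) (f : MvPolynomial σ A) : A :=
  MvPolynomial.aeval (fun a : DegLE σ d => f.coeff a.1) G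

/-- `f` has a multiple root: a complex point at which `f` and all its first order partial
derivatives vanish. -/
def HasMultipleRoot {σ : Type*} (f : MvPolynomial σ ℂ) : Prop :=
  ∃ y : σ → ℂ, MvPolynomial.eval y f = 0 ∧
    ∀ i : σ, MvPolynomial.eval y (MvPolynomial.pderiv i f) = 0

/-- The integer polynomials in the coefficients that vanish at every complex polynomial of degree
at most `d` with a multiple root (equivalently, on the Zariski closure of the set of these). -/
def discriminantIdeal (σ : Type*) (d : ℕ) : Ideal (MvPolynomial (DegLE σ d) ℤ) where
  carrier := {G | ∀ f : MvPolynomial σ ℂ, f.totalDegree ≤ d → HasMultipleRoot f →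
    evalCoeffs G f = 0}
  zero_mem' := fun f _ _ => by simp [evalCoeffs]
  add_mem' := fun {G H} hG hH f hd hf => by
    have h1 := hG f hd hf
    have h2 := hH f hd hf
    simp only [evalCoeffs] at h1 h2
    simp [evalCoeffs, h1, h2]
  smul_mem' := fun c G hG f hd hf => by
    have h1 := hG f hd hf
    simp only [evalCoeffs] at h1
    simp [evalCoeffs, h1]

/-- In a unique factorization domain every set has a greatest common divisor. -/
theorem exists_set_gcd {A : Type*} [CommRing A] [IsDomain A] [UniqueFactorizationMonoid A]
    (S : Set A) : ∃ g : A, ∀ e : A, e ∣ g ↔ ∀ s ∈ S, e ∣ s := by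
  classical
  let _ : GCDMonoid A := UniqueFactorizationMonoid.toGCDMonoid A
  let T : Set A := {g | ∀ e, (∀ s ∈ S, e ∣ s) → e ∣ g}
  have hT : T.Nonempty := ⟨0, fun e _ => dvd_zero e⟩
  obtain ⟨g, hg, hmin⟩ := (wellFounded_dvdNotUnit (α := A)).has_min T hT
  refine ⟨g, fun e => ⟨fun h s hs => h.trans ?_, hg e⟩⟩
  by_contra hne
  have hin : gcd g s ∈ T := fun e' he' => dvd_gcd (hg e' he') (he' s hs)
  exact hmin _ hin
    (dvdNotUnit_of_dvd_of_not_dvd (gcd_dvd_left g s) fun h2 => hne (h2.trans (gcd_dvd_right g s)))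

/-- The discriminant of polynomials of degree at most `d` in the variables `σ`, an integer
polynomial in their coefficients, well defined up to sign: the equation of the Zariski closure of
the set of complex polynomials with a multiple root.  The greatest common divisor of the vanishing
ideal is the irreducible integral equation of that closure if it is a hypersurface, and is `±1` if
the closure is irreducible of codimension at least two (the usual convention). -/
def multiDiscriminant (σ : Type*) (d : ℕ) : MvPolynomial (DegLE σ d) ℤ :=
  (exists_set_gcd (discriminantIdeal σ d : Set (MvPolynomial (DegLE σ d) ℤ))).choose

theorem dvd_multiDiscriminant_iff {σ : Type*} {d : ℕ} (e : MvPolynomial (DegLE σ d) ℤ) :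
    e ∣ multiDiscriminant σ d ↔ ∀ G ∈ discriminantIdeal σ d, e ∣ G :=
  (exists_set_gcd (discriminantIdeal σ d : Set (MvPolynomial (DegLE σ d) ℤ))).choose_spec e

/-- The degree `d` discriminant of the polynomial `f`. -/
def discOfDegree {σ A : Type*} [CommRing A] (d : ℕ) (f : MvPolynomial σ A) : A :=
  evalCoeffs (multiDiscriminant σ d) f

/-! ### Operators on 2-forms -/

section Curvature

variable {V : Type*} [NormedAddCommGroup V] [InnerProductSpace ℝ V] {n : ℕ}

/-- A curvature operator, as a 4-linear form: it is skew in the first two arguments and symmetric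
under exchange of the two pairs of arguments, so it is the same as a symmetric operator on 2-forms.
All Riemann curvature tensors are of this kind; the first Bianchi identity is not imposed. -/
structure IsCurvatureOperator (R : MultilinearMap ℝ (fun _ : Fin 4 => V) ℝ) : Prop where
  skew : ∀ a b c d : V, R ![b, a, c, d] = -R ![a, b, c, d]
  pair_symm : ∀ a b c d : V, R ![c, d, a, b] = R ![a, b, c, d]

/-- Indices of the orthonormal basis `e i ∧ e j`, `i < j`, of the space of 2-forms. -/
abbrev PairIdx (n : ℕ) : Type := {ij : Fin n × Fin n // ij.1 < ij.2}

/-- The matrix, in the orthonormal basis `e i ∧ e j`, `i < j`, of the operator on 2-forms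
that a 4-linear form induces through the metric. -/
def pairMatrix (e : OrthonormalBasis (Fin n) ℝ V)
    (T : MultilinearMap ℝ (fun _ : Fin 4 => V) ℝ) : Matrix (PairIdx n) (PairIdx n) ℝ :=
  Matrix.of fun a b => T ![e a.1.1, e a.1.2, e b.1.1, e b.1.2]

/-- `p(x, z) = det (R - x I - ∑ z_s K_s)`, a polynomial in the variables `z_s` whose coefficients
are polynomials in `x`. -/
def curvaturePoly {ι : Type*} [Fintype ι] (e : OrthonormalBasis (Fin n) ℝ V)
    (R : MultilinearMap ℝ (fun _ : Fin 4 => V) ℝ) (K : ι → V [⋀^Fin 4]→ₗ[ℝ] ℝ) :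
    MvPolynomial ι ℝ[X] :=
  Matrix.det
    ((pairMatrix e R).map (fun r => MvPolynomial.C (Polynomial.C r))
      - (MvPolynomial.C Polynomial.X : MvPolynomial ι ℝ[X]) •
          (1 : Matrix (PairIdx n) (PairIdx n) (MvPolynomial ι ℝ[X]))
      - ∑ s : ι, (MvPolynomial.X s : MvPolynomial ι ℝ[X]) •
          (pairMatrix e (K s).toMultilinearMap).map
            (fun r => MvPolynomial.C (Polynomial.C r)))

end Curvature

end

/-!
The idea is that the matrices `M` for which `det (M - ∑ s, z s • K s)` has a multiple root `z` are
Zariski dense among the symmetric ones.  Every `z` at which `M - ∑ s, z s • K s` has corank at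
least two is a multiple root (`eval_pderiv_detPencil_eq_zero`), and although symmetric matrices of
corank two have codimension three, adding 4-forms to them makes up for it: when `5 ≤ n` there are
2-forms `α` and `β` for which `α ∧ α`, `α ∧ β` and `β ∧ β` are linearly independent, so the
4-forms induce all quadratic forms on the span of `α` and `β` (`exists_fourForm_of_values`).  By
the implicit function theorem, every small symmetric perturbation of the projection `S` with
kernel spanned by `α` and `β` then has corank two modulo 4-forms
(`eventually_exists_kernel_pair`).  On the line from `S` to `R - x` the discriminant is a
polynomial in the parameter that vanishes near `S`, hence also at `R - x`
(`discOfDegree_detPencil_eq_zero`).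

Two further points make this rigorous.  The discriminant, a greatest common divisor of the integer
polynomials that vanish at polynomials with a multiple root, must vanish there itself.  This is
`multiDiscriminant_mem_discriminantIdeal`: in degree `2 ≤ d` the vanishing ideal is a prime ideal
that contains no nonzero polynomial free of the constant coefficient, by a Jacobian argument with
the Hessian matrix of the generic polynomial, and such an ideal is principal.  Moreover, `d` bounds
the degree of `det (R - x - ∑ s, z s • K s)` only, while the argument needs the bound for all
matrices `M` in place of `R - x`.  The degree in `z` is governed by the ranks of the 4-forms:
`det (M - X • N)` has degree at most the rank of the symmetric matrix `N`, with equality for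
`M = -1` (`natDegree_detLine_le_neg_one`), and the latter determinant is a limit of rescaled
determinants with `R - x` (`natDegree_detLine_neg_one_le`).
-/

/-! ### Prime ideals of a polynomial ring that contract to zero -/

theorem Polynomial.exists_map_eq_C_mul {A : Type*} [CommRing A] [IsDomain A]
    (k : (FractionRing A)[X]) : ∃ b : A, b ≠ 0 ∧ ∃ k' : A[X],
      k'.map (algebraMap A (FractionRing A)) =
        Polynomial.C (algebraMap A (FractionRing A) b) * k := by
  obtain ⟨b, hb, h⟩ := IsLocalization.integerNormalization_spec (nonZeroDivisors A) k
  exact ⟨b, nonZeroDivisors.ne_zero hb, _, by rw [h, algebra_compatible_smul (FractionRing A),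
    Polynomial.smul_eq_C_mul]⟩

/-- A prime ideal of `A[X]` that meets the constants in zero is principal.  It contains a prime
element `f`; an element of the ideal that `f` does not divide is coprime to `f` over the fraction
field, and clearing denominators in a Bézout relation gives a nonzero constant in the ideal. -/
theorem Polynomial.exists_generator_of_forall_C_mem {A : Type*} [CommRing A] [IsDomain A]
    [UniqueFactorizationMonoid A] (I : Ideal A[X]) [hI : I.IsPrime]
    (h0 : ∀ a : A, Polynomial.C a ∈ I → a = 0) : ∃ f ∈ I, ∀ g ∈ I, f ∣ g := by
  classical
  by_cases hbot : I = ⊥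
  · exact ⟨0, I.zero_mem, fun g hg => by simp_all⟩
  obtain ⟨f, hfI, hf⟩ := hI.exists_mem_prime_of_ne_bot hbot
  refine ⟨f, hfI, fun g hg => ?_⟩
  let _ : NormalizedGCDMonoid A := Nonempty.some inferInstance
  have hirr := hf.irreducible
  have hdeg : f.natDegree ≠ 0 := by
    intro h
    obtain ⟨a, rfl⟩ := Polynomial.natDegree_eq_zero.mp h
    exact hf.ne_zero (by rw [h0 a hfI, Polynomial.C_0])
  have hprim : f.IsPrimitive := hirr.isPrimitive hdeg
  have hinj := Polynomial.map_injective _ (IsFractionRing.injective A (FractionRing A))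
  have hirrF : Irreducible (f.map (algebraMap A (FractionRing A))) :=
    hprim.irreducible_iff_irreducible_map_fraction_map.mp hirr
  by_contra hfg
  have hndvd : ¬ f.map (algebraMap A (FractionRing A)) ∣ g.map (algebraMap A (FractionRing A)) := by
    rintro ⟨k, hk⟩
    -- `f` is a prime that divides a constant multiple of `g`, and it divides no nonzero constant
    obtain ⟨b, hb0, k', hb⟩ := exists_map_eq_C_mul k
    have h1 : Polynomial.C b * g = f * k' := by
      apply hinj
      rw [Polynomial.map_mul, Polynomial.map_mul, hk, hb, Polynomial.map_C]
      ring
    rcases hf.dvd_or_dvd (Dvd.intro _ h1.symm) with h2 | h2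
    · exact hb0 (h0 _ (I.mem_of_dvd h2 hfI))
    · exact hfg h2
  obtain ⟨u, v, huv⟩ := (hirrF.coprime_iff_not_dvd).mpr hndvd
  obtain ⟨b, hb0, u', hu⟩ := exists_map_eq_C_mul u
  obtain ⟨c, hc0, v', hv⟩ := exists_map_eq_C_mul v
  have h1 : Polynomial.C (b * c) = Polynomial.C c * u' * f + Polynomial.C b * v' * g := by
    apply hinj
    simp only [Polynomial.map_mul, Polynomial.map_add, Polynomial.map_C, hu, hv, map_mul]
    linear_combination (-Polynomial.C (algebraMap A (FractionRing A) b) *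
      Polynomial.C (algebraMap A (FractionRing A) c)) * huv
  exact mul_ne_zero hb0 hc0 (h0 _ (h1 ▸ I.add_mem (I.mul_mem_left _ hfI) (I.mul_mem_left _ hg)))

open MvPolynomial in
/-- The same for a polynomial ring in several variables, one of which is singled out: a prime ideal
that contains no nonzero polynomial free of the variable `i` is principal. -/
theorem MvPolynomial.exists_generator_of_forall_pderiv_eq_zero {τ A : Type*} [CommRing A]
    [IsDomain A] [UniqueFactorizationMonoid A] (i : τ) (I : Ideal (MvPolynomial τ A))
    [hI : I.IsPrime] (h0 : ∀ H ∈ I, pderiv i H = 0 → H = 0) : ∃ f ∈ I, ∀ g ∈ I, f ∣ g := by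
  classical
  let ε : Option {j : τ // j ≠ i} ≃ τ := ((Equiv.optionSubtype i).symm (Equiv.refl _)).1
  let E : MvPolynomial τ A ≃ₐ[A] (MvPolynomial {j : τ // j ≠ i} A)[X] :=
    (renameEquiv A ε.symm).trans (optionEquivLeft A _)
  have hE : ∀ a : MvPolynomial {j : τ // j ≠ i} A,
      E.symm (Polynomial.C a) = rename Subtype.val a := by
    intro a
    rw [AlgEquiv.symm_apply_eq]
    induction a using MvPolynomial.induction_on with
    | C a => simp [E, optionEquivLeft_C]
    | add p q hp hq => rw [map_add, hp, hq, map_add, map_add]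
    | mul_X p j h =>
      have hj : ε.symm j.1 = some j := by
        rw [Equiv.symm_apply_eq]; simp [ε, Equiv.optionSubtype]
      rw [map_mul, h, map_mul, map_mul, rename_X]
      congr 1
      simp [E, hj, optionEquivLeft_X_some]
  obtain ⟨f, hf, hfd⟩ := Polynomial.exists_generator_of_forall_C_mem
    (A := MvPolynomial {j : τ // j ≠ i} A) (I.comap E.symm) (fun a ha => by
      have h1 : rename Subtype.val a ∈ I := by rw [← hE]; exact ha
      have h2 := h0 _ h1 (pderiv_eq_zero_of_notMem_vars fun hi => by
        have := vars_rename _ a hi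
        simp at this)
      exact rename_injective _ Subtype.val_injective (by rw [h2, map_zero]))
  refine ⟨E.symm f, hf, fun g hg => ?_⟩
  have := hfd (E g) (by simpa [Ideal.mem_comap] using hg)
  simpa using map_dvd E.symm this

open MvPolynomial
open scoped Matrix Topology

/-! ### The universal polynomial with a multiple root -/

theorem evalCoeffs_map {σ A B : Type*} [CommRing A] [CommRing B] {d : ℕ} (ψ : A →+* B)
    (G : MvPolynomial (DegLE σ d) ℤ) (f : MvPolynomial σ A) :
    evalCoeffs G (map ψ f) = ψ (evalCoeffs G f) := by
  simp only [evalCoeffs, coeff_map, aeval_def, eval₂_eq, map_sum, map_mul, map_prod, map_pow]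
  simp

section TangentRemainder

variable {σ A B : Type*} [Fintype σ] [CommRing A] [CommRing B]

/-- What remains of `h` after its first order Taylor polynomial at `y` is subtracted: the
polynomial with a multiple root at `y` that has the same terms of degree at least two as `h`. -/
noncomputable def tangentRemainder (y : σ → A) (h : MvPolynomial σ A) : MvPolynomial σ A :=
  h - C (eval y h) - ∑ i, C (eval y (pderiv i h)) * (X i - C (y i))

theorem eval_tangentRemainder (y : σ → A) (h : MvPolynomial σ A) :
    eval y (tangentRemainder y h) = 0 := by
  simp [tangentRemainder]

theorem eval_pderiv_tangentRemainder (y : σ → A) (h : MvPolynomial σ A) (j : σ) :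
    eval y (pderiv j (tangentRemainder y h)) = 0 := by
  classical
  simp [tangentRemainder, Pi.single_apply]

theorem totalDegree_tangentRemainder_le (y : σ → A) (h : MvPolynomial σ A) {d : ℕ} (hd : 1 ≤ d)
    (hh : h.totalDegree ≤ d) : (tangentRemainder y h).totalDegree ≤ d := by
  refine (totalDegree_sub _ _).trans (max_le ((totalDegree_sub _ _).trans (max_le hh (by simp))) ?_)
  refine totalDegree_finsetSum_le fun i _ => (totalDegree_mul _ _).trans ?_
  refine (add_le_add (totalDegree_C _).le (totalDegree_sub _ _)).trans ?_
  have : (X i : MvPolynomial σ A).totalDegree ≤ 1 :=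
    (totalDegree_monomial_le _ _).trans (by simp)
  simp only [totalDegree_C, zero_add]
  omega

theorem tangentRemainder_eq_self {y : σ → A} {h : MvPolynomial σ A} (h0 : eval y h = 0)
    (h1 : ∀ i, eval y (pderiv i h) = 0) : tangentRemainder y h = h := by
  simp [tangentRemainder, h0, h1]

theorem map_tangentRemainder (ψ : A →+* B) (y : σ → A) (h : MvPolynomial σ A) :
    map ψ (tangentRemainder y h) = tangentRemainder (ψ ∘ y) (map ψ h) := by
  have h1 : ∀ g : MvPolynomial σ A, eval (ψ ∘ y) (map ψ g) = ψ (eval y g) := fun g =>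
    map_eval ψ y g |>.symm
  simp only [tangentRemainder, map_sub, map_sum, map_mul, map_C, map_X, pderiv_map, h1,
    Function.comp_apply]

theorem coeff_tangentRemainder_single (y : σ → A) (h : MvPolynomial σ A) (i : σ) :
    coeff (Finsupp.single i 1) (tangentRemainder y h) =
      coeff (Finsupp.single i 1) h - eval y (pderiv i h) := by
  classical
  simp [tangentRemainder, coeff_sum, coeff_C_mul, coeff_X, coeff_C, Finsupp.single_left_inj,
    eq_comm (a := (0 : σ →₀ ℕ))]

theorem coeff_tangentRemainder_of_two_le (y : σ → A) (h : MvPolynomial σ A) {a : σ →₀ ℕ}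
    (ha : 2 ≤ a.degree) : coeff a (tangentRemainder y h) = coeff a h := by
  classical
  have h0 : 0 ≠ a := by rintro rfl; simp at ha
  have h1 : ∀ i, Finsupp.single i 1 ≠ a := by rintro i rfl; simp at ha
  simp [tangentRemainder, coeff_sum, coeff_C_mul, coeff_X, coeff_C, h0, h1]

end TangentRemainder

section Universal

variable (σ : Type*) [Fintype σ] (d : ℕ)

instance : Finite (DegLE σ d) := Set.Finite.to_subtype (Finsupp.finite_of_degree_le d)

noncomputable instance : Fintype (DegLE σ d) := Fintype.ofFinite _

/-- The generic polynomial of degree at most `d`; its coefficients are indeterminates. -/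
noncomputable def genericPoly : MvPolynomial σ (MvPolynomial (DegLE σ d) ℤ) :=
  ∑ a : DegLE σ d, monomial a.1 (X a)

/-- Indeterminates for the coordinates of a point and the coefficients of a polynomial. -/
abbrev PointPolyRing : Type _ := MvPolynomial (σ ⊕ DegLE σ d) ℤ

/-- The inclusion of the coefficient ring of the generic polynomial. -/
noncomputable def coeffIncl : MvPolynomial (DegLE σ d) ℤ →+* PointPolyRing σ d :=
  (rename Sum.inr : MvPolynomial (DegLE σ d) ℤ →ₐ[ℤ] PointPolyRing σ d)

/-- The generic point. -/
noncomputable def universalPoint (i : σ) : PointPolyRing σ d := X (Sum.inl i)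

/-- The generic polynomial with a multiple root at the generic point. -/
noncomputable def universalSingular : MvPolynomial σ (PointPolyRing σ d) :=
  tangentRemainder (universalPoint σ d) (map (coeffIncl σ d) (genericPoly σ d))

variable {σ d}

theorem coeff_genericPoly (a : DegLE σ d) : coeff a.1 (genericPoly σ d) = X a := by
  classical
  simp [genericPoly, coeff_sum, coeff_monomial, Subtype.val_inj]

/-- Polynomials of degree at most `d` are the specializations of the generic one. -/
theorem map_genericPoly {A : Type*} [CommRing A] {f : MvPolynomial σ A}
    (hf : f.totalDegree ≤ d) {ψ : PointPolyRing σ d →+* A}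
    (hψ : ∀ a : DegLE σ d, ψ (X (Sum.inr a)) = f.coeff a.1) :
    map ψ (map (coeffIncl σ d) (genericPoly σ d)) = f := by
  classical
  rw [map_map]
  ext a
  rw [coeff_map]
  by_cases ha : a.degree ≤ d
  · rw [coeff_genericPoly ⟨a, ha⟩]
    simp [coeffIncl, hψ]
  · have h1 : coeff a (genericPoly σ d) = 0 := by
      rw [genericPoly, coeff_sum]
      refine Finset.sum_eq_zero fun b _ => ?_
      rw [coeff_monomial, if_neg]
      rintro rfl
      exact ha b.2
    rw [h1, map_zero, eq_comm]
    exact coeff_eq_zero_of_totalDegree_lt (lt_of_le_of_lt hf (by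
      simpa [Finsupp.degree_apply] using not_le.mp ha))

theorem map_universalSingular {A : Type*} [CommRing A] {f : MvPolynomial σ A}
    (hf : f.totalDegree ≤ d) (y : σ → A) {ψ : PointPolyRing σ d →+* A}
    (hψ : ∀ a : DegLE σ d, ψ (X (Sum.inr a)) = f.coeff a.1)
    (hy : ∀ i, ψ (X (Sum.inl i)) = y i) :
    map ψ (universalSingular σ d) = tangentRemainder y f := by
  rw [universalSingular, map_tangentRemainder, map_genericPoly hf hψ]
  congr 1
  exact _root_.funext hy

/-- The discriminant ideal consists of the relations between the coefficients of the universal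
polynomial with a multiple root. -/
theorem mem_discriminantIdeal_iff (hd : 1 ≤ d) (G : MvPolynomial (DegLE σ d) ℤ) :
    G ∈ discriminantIdeal σ d ↔ evalCoeffs G (universalSingular σ d) = 0 := by
  constructor
  · intro hG
    apply map_injective (Int.castRingHom ℂ) Int.cast_injective
    apply MvPolynomial.funext
    intro pt
    rw [eval_map, map_zero, map_zero, ← coe_eval₂Hom, ← evalCoeffs_map]
    set f : MvPolynomial σ ℂ := ∑ a : DegLE σ d, monomial a.1 (pt (Sum.inr a)) with hf
    have hdeg : f.totalDegree ≤ d := totalDegree_finsetSum_le fun a _ =>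
      (totalDegree_monomial_le _ _).trans (by simpa [Finsupp.degree_apply, Finsupp.sum] using a.2)
    have hco : ∀ a : DegLE σ d, f.coeff a.1 = pt (Sum.inr a) := by
      classical
      intro a
      simp [hf, coeff_sum, coeff_monomial, Subtype.val_inj]
    rw [map_universalSingular hdeg (pt ∘ Sum.inl) (by simp [hco]) (by simp)]
    exact hG _ (totalDegree_tangentRemainder_le _ _ hd hdeg)
      ⟨_, eval_tangentRemainder _ _, eval_pderiv_tangentRemainder _ _⟩
  · rintro hG f hf ⟨y, h0, h1⟩
    have h := map_universalSingular hf y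
      (ψ := eval₂Hom (Int.castRingHom ℂ) (Sum.elim y fun a => f.coeff a.1)) (by simp) (by simp)
    rw [tangentRemainder_eq_self h0 h1] at h
    rw [← h, evalCoeffs_map, hG, map_zero]

theorem isPrime_discriminantIdeal (hd : 1 ≤ d) : (discriminantIdeal σ d).IsPrime := by
  have h : discriminantIdeal σ d =
      RingHom.ker (aeval fun a : DegLE σ d => (universalSingular σ d).coeff a.1 :
        MvPolynomial (DegLE σ d) ℤ →ₐ[ℤ] PointPolyRing σ d) := by
    ext G
    rw [mem_discriminantIdeal_iff hd, RingHom.mem_ker]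
    rfl
  rw [h]
  exact RingHom.ker_isPrime _

/-- Chain rule for substitution into an integer polynomial. -/
theorem pderiv_aeval {τ κ : Type*} [Fintype τ] (F : τ → MvPolynomial κ ℤ) (H : MvPolynomial τ ℤ)
    (k : κ) : pderiv k (aeval F H) = ∑ b, aeval F (pderiv b H) * pderiv k (F b) := by
  classical
  induction H using MvPolynomial.induction_on with
  | C a => simp
  | add p q hp hq => simp only [map_add, hp, hq, add_mul, Finset.sum_add_distrib]
  | mul_X p c h =>
    simp only [map_mul, aeval_X, pderiv_mul, h, map_add, add_mul, Finset.sum_add_distrib,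
      pderiv_X, Finset.sum_mul]
    congr 1
    · exact Finset.sum_congr rfl fun b _ => by ring
    · rw [Finset.sum_eq_single c]
      · simp
      · intro b _ hb; simp [hb.symm]
      · simp

/-- Differentiating a value at the generic point in the coordinates of the point: the coefficients
of the polynomial do not depend on them. -/
theorem pderiv_inl_eval_universalPoint {σ : Type*} {d : ℕ}
    (P : MvPolynomial σ (MvPolynomial (DegLE σ d) ℤ))
    (j : σ) : pderiv (Sum.inl j) (eval (universalPoint σ d) (map (coeffIncl σ d) P)) =
      eval (universalPoint σ d) (map (coeffIncl σ d) (pderiv j P)) := by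
  classical
  induction P using MvPolynomial.induction_on with
  | C a =>
    simp only [map_C, eval_C, pderiv_C, map_zero]
    refine pderiv_eq_zero_of_notMem_vars fun h => ?_
    have := vars_rename _ a h
    simp at this
  | add p q hp hq => simp only [map_add, hp, hq]
  | mul_X p c h =>
    simp only [map_mul, map_X, eval_X, pderiv_mul, h, map_add]
    congr 2
    by_cases hc : c = j
    · subst hc; simp [universalPoint]
    · simp [universalPoint, pderiv_X_of_ne hc, pderiv_X_of_ne (fun h => hc (Sum.inl_injective h))]

end Universal

section
variable {σ : Type*} [Fintype σ] {d : ℕ}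

/-! ### The discriminant vanishes at polynomials with a multiple root -/

theorem MvPolynomial.pderiv_comm {τ A : Type*} [CommRing A] (i j : τ) (H : MvPolynomial τ A) :
    pderiv i (pderiv j H) = pderiv j (pderiv i H) := by
  classical
  ext m
  rw [coeff_pderiv, coeff_pderiv, coeff_pderiv, coeff_pderiv, add_right_comm]
  by_cases h : i = j
  · subst h; ring
  · simp [h, Ne.symm h]
    ring

theorem MvPolynomial.totalDegree_pderiv_lt {τ A : Type*} [CommRing A] (i : τ)
    {H : MvPolynomial τ A} (hH : 0 < H.totalDegree) : (pderiv i H).totalDegree < H.totalDegree := by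
  rw [totalDegree, Finset.sup_lt_iff hH]
  intro m hm
  have h1 : coeff (m + Finsupp.single i 1) H ≠ 0 := by
    intro h
    rw [mem_support_iff, coeff_pderiv, h, zero_mul] at hm
    exact hm rfl
  have h2 := le_totalDegree (mem_support_iff.mpr h1)
  rw [Finsupp.sum_add_index' (by simp) (by simp)] at h2
  simp at h2
  exact h2

theorem MvPolynomial.totalDegree_map_le {τ A B : Type*} [CommRing A] [CommRing B] (ψ : A →+* B)
    (f : MvPolynomial τ A) : (map ψ f).totalDegree ≤ f.totalDegree :=
  Finset.sup_mono (support_map_subset _ _)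

theorem MvPolynomial.totalDegree_eq_zero_of_forall_pderiv {τ : Type*} {H : MvPolynomial τ ℤ}
    (h : ∀ i, pderiv i H = 0) : H.totalDegree = 0 := by
  rw [totalDegree_eq_zero_iff]
  intro m hm i
  by_contra hi
  have h1 := congrArg (coeff (m - Finsupp.single i 1)) (h i)
  have h2 : m - Finsupp.single i 1 + Finsupp.single i 1 = m :=
    tsub_add_cancel_of_le (by simpa [Finsupp.single_le_iff] using Nat.one_le_iff_ne_zero.mpr hi)
  rw [coeff_pderiv, h2, coeff_zero] at h1
  rcases mul_eq_zero.mp h1 with h3 | h3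
  · exact (mem_support_iff.mp hm) h3
  · norm_cast at h3

/-- The exponent of a variable. -/
noncomputable def varIdx (hd : 2 ≤ d) (i : σ) : DegLE σ d :=
  ⟨Finsupp.single i 1, by simp; omega⟩

variable (σ d) in
/-- The Hessian matrix of the generic polynomial at the generic point. -/
noncomputable def universalHessian : Matrix σ σ (PointPolyRing σ d) :=
  Matrix.of fun i j => eval (universalPoint σ d)
    (map (coeffIncl σ d) (pderiv j (pderiv i (genericPoly σ d))))

/-- The Hessian determinant does not vanish, because the quadratic form `∑ t_i ^ 2` is
nondegenerate. -/
theorem det_universalHessian_ne_zero [DecidableEq σ] (hd : 2 ≤ d) :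
    (universalHessian σ d).det ≠ 0 := by
  intro h
  set f : MvPolynomial σ ℤ := ∑ i, X i ^ 2 with hf
  have hdeg : f.totalDegree ≤ d := totalDegree_finsetSum_le fun i _ => by
    rw [totalDegree_X_pow]; exact hd
  let ψ : PointPolyRing σ d →+* ℤ := eval (Sum.elim (fun _ => 0) fun a => f.coeff a.1)
  have h1 : map ψ (map (coeffIncl σ d) (genericPoly σ d)) = f :=
    map_genericPoly hdeg (by simp [ψ])
  have h2 : ψ.mapMatrix (universalHessian σ d) = Matrix.diagonal fun _ => 2 := by
    ext i j
    have h3 : ψ (universalHessian σ d i j) =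
        eval (ψ ∘ universalPoint σ d) (pderiv j (pderiv i f)) := by
      rw [universalHessian, Matrix.of_apply, map_eval, ← pderiv_map, ← pderiv_map, ← pderiv_map,
        ← pderiv_map, h1]
    rw [RingHom.mapMatrix_apply, Matrix.map_apply, h3, hf]
    have h5 : pderiv j (2 : MvPolynomial σ ℤ) = 0 := pderiv_C (a := 2)
    simp [Pi.single_apply, Matrix.diagonal_apply, eq_comm, h5, apply_ite]
  have h4 := congrArg ψ h
  rw [RingHom.map_det, h2, map_zero, Matrix.det_diagonal] at h4
  simp at h4

theorem pderiv_inl_coeff_universalSingular_varIdx (hd : 2 ≤ d) (i j : σ) :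
    pderiv (Sum.inl j) (coeff (varIdx hd i).1 (universalSingular σ d)) =
      - universalHessian σ d i j := by
  rw [varIdx, universalSingular, coeff_tangentRemainder_single, map_sub, pderiv_map,
    pderiv_inl_eval_universalPoint, coeff_map]
  have h := coeff_genericPoly (varIdx hd i)
  rw [varIdx] at h
  simp [h, coeffIncl, universalHessian, pderiv_X_of_ne]

theorem coeff_universalSingular_of_two_le {b : DegLE σ d} (hb : 2 ≤ b.1.degree) :
    coeff b.1 (universalSingular σ d) = X (Sum.inr b) := by
  rw [universalSingular, coeff_tangentRemainder_of_two_le _ _ hb, coeff_map, coeff_genericPoly]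
  simp [coeffIncl]

/-- The coefficients of positive degree of a polynomial with a multiple root satisfy no relation.
Differentiating a relation of least degree in the coordinates of the root and applying the
invertible Hessian matrix shows that its derivatives in the linear coefficients are again
relations, and the derivatives in the higher coefficients are relations as well. -/
theorem eq_zero_of_evalCoeffs_universalSingular (hd : 2 ≤ d) (H : MvPolynomial (DegLE σ d) ℤ)
    (h0 : pderiv ⟨0, by simp⟩ H = 0) (hH : evalCoeffs H (universalSingular σ d) = 0) : H = 0 := by
  classical
  induction hn : H.totalDegree using Nat.strong_induction_on generalizing H with
  | _ n ih =>
  subst hn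
  let F : DegLE σ d → PointPolyRing σ d := fun b => (universalSingular σ d).coeff b.1
  change aeval F H = 0 at hH
  -- every exponent is zero, that of a variable, or of degree at least two
  have hcases : ∀ b : DegLE σ d, b = ⟨0, by simp⟩ ∨ (∃ i, varIdx hd i = b) ∨ 2 ≤ b.1.degree := by
    intro b
    rcases Nat.lt_or_ge b.1.degree 2 with h | h
    · interval_cases hb : b.1.degree
      · exact Or.inl (Subtype.ext ((Finsupp.degree_eq_zero_iff _).mp hb))
      · obtain ⟨i, hi⟩ : b.1 ∈ Set.range fun i => Finsupp.single i 1 := by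
          rw [Finsupp.range_single_one]
          exact hb
        exact Or.inr (Or.inl ⟨i, Subtype.ext hi⟩)
    · exact Or.inr (Or.inr h)
  have hsum : ∀ k, ∑ b, aeval F (pderiv b H) * pderiv k (F b) = 0 := fun k => by
    rw [← pderiv_aeval, hH, map_zero]
  have hinj : Function.Injective (varIdx hd : σ → DegLE σ d) := fun i j h =>
    Finsupp.single_left_injective one_ne_zero (congrArg Subtype.val h)
  have hlin : ∀ i, aeval F (pderiv (varIdx hd i) H) = 0 := by
    have h1 : Matrix.vecMul (fun i => aeval F (pderiv (varIdx hd i) H))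
        (universalHessian σ d) = 0 := by
      funext j
      rw [Pi.zero_apply, ← neg_eq_zero, ← hsum (Sum.inl j), Matrix.vecMul, dotProduct,
        ← Finset.sum_neg_distrib]
      refine Fintype.sum_of_injective _ hinj _ _ (fun b hb => ?_) fun i => ?_
      · rcases hcases b with rfl | h | h
        · rw [h0, map_zero, zero_mul]
        · exact absurd h hb
        · simp only [F]
          rw [coeff_universalSingular_of_two_le h, pderiv_X_of_ne (by simp), mul_zero]
      · simp only [F]
        rw [pderiv_inl_coeff_universalSingular_varIdx, mul_neg]
    exact congrFun (Matrix.eq_zero_of_vecMul_eq_zero (det_universalHessian_ne_zero hd) h1)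
  have hall : ∀ b, aeval F (pderiv b H) = 0 := by
    intro b
    rcases hcases b with rfl | ⟨i, rfl⟩ | h
    · rw [h0, map_zero]
    · exact hlin i
    · rw [← hsum (Sum.inr b), Finset.sum_eq_single b]
      · simp only [F]
        rw [coeff_universalSingular_of_two_le h, pderiv_X_self, mul_one]
      · intro c _ hcb
        rcases hcases c with rfl | ⟨i, rfl⟩ | h'
        · rw [h0, map_zero, zero_mul]
        · rw [hlin, zero_mul]
        · simp only [F]
          rw [coeff_universalSingular_of_two_le h', pderiv_X_of_ne (by simpa using hcb), mul_zero]
      · simp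
  have hdeg : H.totalDegree = 0 := by
    by_contra hpos
    refine hpos (totalDegree_eq_zero_of_forall_pderiv fun b => ?_)
    exact ih _ (totalDegree_pderiv_lt b (Nat.pos_of_ne_zero hpos)) _
      (by rw [pderiv_comm, h0, map_zero]) (hall b) rfl
  obtain ⟨a, ha⟩ : ∃ a, H = C a := ⟨_, totalDegree_eq_zero_iff_eq_C.mp hdeg⟩
  rw [ha, aeval_C] at hH
  have : a = 0 := by simpa using hH
  rw [ha, this, C_0]

/-- In degree at least two the vanishing ideal is principal, so the discriminant, its greatest
common divisor, is one of its elements. -/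
theorem multiDiscriminant_mem_discriminantIdeal (hd : 2 ≤ d) :
    multiDiscriminant σ d ∈ discriminantIdeal σ d := by
  have hd1 : 1 ≤ d := by omega
  have := isPrime_discriminantIdeal (σ := σ) hd1
  obtain ⟨f, hf, hdvd⟩ := MvPolynomial.exists_generator_of_forall_pderiv_eq_zero
    (⟨0, by simp⟩ : DegLE σ d) (discriminantIdeal σ d) fun H hH h0 =>
      eq_zero_of_evalCoeffs_universalSingular hd H h0 ((mem_discriminantIdeal_iff hd1 H).mp hH)
  exact Ideal.mem_of_dvd _ ((dvd_multiDiscriminant_iff f).mpr hdvd) hf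

/-- The discriminant of a real polynomial with a real multiple root is zero. -/
theorem discOfDegree_eq_zero_of_multiple_root (hd : 2 ≤ d) {f : MvPolynomial σ ℝ}
    (hf : f.totalDegree ≤ d) (z : σ → ℝ) (h0 : eval z f = 0)
    (h1 : ∀ i, eval z (pderiv i f) = 0) : discOfDegree d f = 0 := by
  have h := multiDiscriminant_mem_discriminantIdeal hd (map Complex.ofRealHom f)
    ((totalDegree_map_le _ f).trans hf)
    ⟨fun i => Complex.ofRealHom (z i), by
      rw [← Function.comp_def, ← map_eval, h0, map_zero], fun i => by
      rw [← Function.comp_def, pderiv_map, ← map_eval, h1, map_zero]⟩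
  rw [evalCoeffs_map] at h
  exact Complex.ofReal_eq_zero.mp h

end

section Pencil

variable {P ι A B : Type*} [Fintype P] [DecidableEq P] [Fintype ι] [CommRing A] [CommRing B]

/-! ### Determinants of pencils of matrices -/

/-- The determinant of `M - ∑ s, z s • N s`, as a polynomial in the `z s`. -/
noncomputable def detPencil (M : Matrix P P A) (N : ι → Matrix P P A) : MvPolynomial ι A :=
  Matrix.det (M.map C - ∑ s, (X s : MvPolynomial ι A) • (N s).map C)

theorem map_detPencil (ψ : A →+* B) (M : Matrix P P A) (N : ι → Matrix P P A) :
    map ψ (detPencil M N) = detPencil (M.map ψ) (fun s => (N s).map ψ) := by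
  rw [detPencil, RingHom.map_det, detPencil]
  congr 1
  ext1 i j
  simp [Matrix.sum_apply, Matrix.sub_apply]

theorem ringHom_detPencil (ψ : MvPolynomial ι A →+* B) (M : Matrix P P A) (N : ι → Matrix P P A) :
    ψ (detPencil M N) =
      (M.map (ψ.comp C) - ∑ s, ψ (X s) • (N s).map (ψ.comp C)).det := by
  rw [detPencil, RingHom.map_det]
  congr 1
  ext1 i j
  simp [Matrix.sum_apply, Matrix.sub_apply]

theorem eval_detPencil (z : ι → A) (M : Matrix P P A) (N : ι → Matrix P P A) :
    eval z (detPencil M N) = (M - ∑ s, z s • N s).det := by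
  rw [ringHom_detPencil]
  congr 1
  ext1 i j
  simp [Matrix.sum_apply, Matrix.sub_apply]

theorem Derivation.leibniz_finset_prod {κ : Type*} [Algebra A B] [DecidableEq κ]
    (D : Derivation A B B) (s : Finset κ) (f : κ → B) :
    D (∏ i ∈ s, f i) = ∑ i ∈ s, ∏ k ∈ s, Function.update f i (D (f i)) k := by
  induction s using Finset.induction_on with
  | empty => simp
  | insert a s ha ih =>
    rw [Finset.prod_insert ha, D.leibniz, Finset.sum_insert ha, ih, Finset.prod_insert ha,
      Function.update_self, smul_eq_mul, smul_eq_mul, Finset.mul_sum, add_comm]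
    congr 1
    · rw [mul_comm]
      congr 1
      exact Finset.prod_congr rfl fun k hk =>
        (Function.update_of_ne (ne_of_mem_of_not_mem hk ha) _ _).symm
    · refine Finset.sum_congr rfl fun i hi => ?_
      rw [Finset.prod_insert ha, Function.update_of_ne (ne_of_mem_of_not_mem hi ha).symm]

/-- The derivative of a determinant is the sum of the determinants with one column
differentiated. -/
theorem Derivation.apply_det [Algebra A B] (D : Derivation A B B) (M : Matrix P P B) :
    D M.det = ∑ i, (M.updateCol i fun k => D (M k i)).det := by
  simp only [Matrix.det_apply', map_sum]
  rw [Finset.sum_comm]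
  refine Finset.sum_congr rfl fun σ _ => ?_
  rw [D.leibniz, Derivation.leibniz_finset_prod, D.map_intCast, smul_zero, add_zero, smul_eq_mul,
    Finset.mul_sum]
  refine Finset.sum_congr rfl fun i _ => ?_
  congr 1
  refine Finset.prod_congr rfl fun k _ => ?_
  rw [Matrix.updateCol_apply, Function.update_apply]
  split_ifs with h
  · rw [h]
  · rfl

/-- A point where the pencil has corank at least two is a multiple root of its determinant: with
one column replaced, the matrix still has a left kernel. -/
theorem eval_pderiv_detPencil_eq_zero {K : Type*} [Field K] {M : Matrix P P K}
    {N : ι → Matrix P P K} {z : ι → K} {a b : P → K} (ha : a ᵥ* (M - ∑ s, z s • N s) = 0)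
    (hb : b ᵥ* (M - ∑ s, z s • N s) = 0) (hab : LinearIndependent K ![a, b]) (j : ι) :
    eval z (pderiv j (detPencil M N)) = 0 := by
  rw [detPencil, Derivation.apply_det, map_sum]
  refine Finset.sum_eq_zero fun i _ => ?_
  rw [RingHom.map_det, ← Matrix.exists_vecMul_eq_zero_iff]
  set L := M - ∑ s, z s • N s with hL
  set L' : Matrix P P (MvPolynomial ι K) :=
    M.map C - ∑ s, (X s : MvPolynomial ι K) • (N s).map C with hL'
  set v : P → K := fun k => eval z (pderiv j (L' k i)) with hv
  have hmat : (eval z).mapMatrix (L'.updateCol i fun k => pderiv j (L' k i)) =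
      L.updateCol i v := by
    ext k l
    by_cases h : l = i
    · subst h; simp [hv]
    · simp [Matrix.updateCol_ne h, hL, hL', Matrix.sum_apply, Matrix.sub_apply]
  rw [hmat]
  -- a combination of `a` and `b` that is orthogonal to the new column
  obtain ⟨c, e, hce, hne⟩ : ∃ c e : K, c * (a ⬝ᵥ v) + e * (b ⬝ᵥ v) = 0 ∧ ¬ (c = 0 ∧ e = 0) := by
    by_cases h : a ⬝ᵥ v = 0
    · exact ⟨1, 0, by simp [h], by simp⟩
    · exact ⟨b ⬝ᵥ v, -(a ⬝ᵥ v), by ring, by simp [h]⟩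
  refine ⟨c • a + e • b, fun h => hne (LinearIndependent.pair_iff.mp hab c e h), ?_⟩
  ext l
  by_cases h : l = i
  · subst h
    simp only [Matrix.vecMul, Pi.zero_apply]
    have h2 : (fun k => L.updateCol l v k l) = v := by ext k; simp
    rw [h2, add_dotProduct, smul_dotProduct, smul_dotProduct]
    exact hce
  · have h2 : (fun k => L.updateCol i v k l) = fun k => L k l := by
      ext k; rw [Matrix.updateCol_ne h]
    have h3 : (c • a + e • b) ᵥ* L = 0 := by
      rw [Matrix.add_vecMul, Matrix.smul_vecMul, Matrix.smul_vecMul, ha, hb]; simp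
    have h4 := congrFun h3 l
    simp only [Matrix.vecMul] at h4 ⊢
    rw [h2, h4]

/-! ### Degrees of determinants of symmetric pencils -/

theorem MvPolynomial.aeval_C_mul_X_monomial {ι A : Type*} [CommRing A] (k : ι → A) (m : ι →₀ ℕ)
    (a : A) : aeval (fun s => Polynomial.C (k s) * Polynomial.X) (monomial m a) =
      Polynomial.monomial m.degree (eval k (monomial m a)) := by
  rw [aeval_monomial, eval_monomial, ← Polynomial.C_mul_X_pow_eq_monomial,
    Finsupp.prod, Finsupp.prod, Finsupp.degree_apply]
  simp only [mul_pow, Finset.prod_mul_distrib, Finset.prod_pow_eq_pow_sum, map_mul, map_prod,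
    map_pow, Polynomial.algebraMap_eq, mul_assoc]

/-- A polynomial whose restrictions to all lines through the origin have degree at most `d` has
degree at most `d`. -/
theorem MvPolynomial.totalDegree_le_of_forall_line {ι K : Type*} [Field K]
    [Infinite K] {f : MvPolynomial ι K} {d : ℕ}
    (h : ∀ k : ι → K, (aeval (fun s => Polynomial.C (k s) * Polynomial.X) f).natDegree ≤ d) :
    f.totalDegree ≤ d := by
  classical
  have hco : ∀ (n : ℕ) (k : ι → K) (f : MvPolynomial ι K),
      (aeval (fun s => Polynomial.C (k s) * Polynomial.X) f).coeff n =
        eval k (homogeneousComponent n f) := by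
    intro n k f
    induction f using MvPolynomial.induction_on' with
    | monomial m a =>
      rw [MvPolynomial.aeval_C_mul_X_monomial, Polynomial.coeff_monomial]
      split_ifs with h
      · rw [homogeneousComponent_of_mem (isHomogeneous_monomial a h)]; simp
      · rw [homogeneousComponent_of_mem (isHomogeneous_monomial a rfl), if_neg (Ne.symm h),
          map_zero]
    | add p q hp hq => rw [map_add, Polynomial.coeff_add, hp, hq, map_add, map_add]
  refine Finset.sup_le fun m hm => ?_
  by_contra! hlt
  have hz : homogeneousComponent m.degree f = 0 := MvPolynomial.funext fun k => by
    rw [map_zero, ← hco]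
    exact Polynomial.coeff_eq_zero_of_natDegree_lt ((h k).trans_lt (by
      simpa [Finsupp.degree_apply, Finsupp.sum] using hlt))
  have := congrArg (coeff m) hz
  rw [coeff_homogeneousComponent, if_pos rfl, coeff_zero] at this
  exact mem_support_iff.mp hm this

/-- The determinant of `M - X • N`. -/
noncomputable def detLine (M N : Matrix P P A) : A[X] :=
  (M.map Polynomial.C - (Polynomial.X : A[X]) • N.map Polynomial.C).det

theorem aeval_line_detPencil (k : ι → A) (M : Matrix P P A) (N : ι → Matrix P P A) :
    aeval (fun s => Polynomial.C (k s) * Polynomial.X) (detPencil M N) =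
      detLine M (∑ s, k s • N s) := by
  change ((aeval fun s => Polynomial.C (k s) * Polynomial.X :
    MvPolynomial ι A →ₐ[A] A[X]) : MvPolynomial ι A →+* A[X]) _ = _
  rw [ringHom_detPencil, detLine]
  congr 1
  ext1 i j
  simp only [Matrix.sub_apply, Matrix.sum_apply, Matrix.map_apply, Matrix.smul_apply, smul_eq_mul,
    RingHom.comp_apply, RingHom.coe_coe, aeval_C, aeval_X, Polynomial.algebraMap_eq, map_sum,
    map_mul, Finset.mul_sum]
  congr 1
  exact Finset.sum_congr rfl fun s _ => by ring

theorem map_detLine (ψ : A →+* B) (M N : Matrix P P A) :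
    (detLine M N).map ψ = detLine (M.map ψ) (N.map ψ) := by
  rw [detLine, ← Polynomial.coe_mapRingHom, RingHom.map_det, detLine]
  congr 1
  ext1 i j
  simp [Matrix.sub_apply]

theorem detLine_mul (U V M N : Matrix P P A) :
    detLine (U * M * V) (U * N * V) = Polynomial.C (U.det * V.det) * detLine M N := by
  have h : (U * M * V).map Polynomial.C - (Polynomial.X : A[X]) • (U * N * V).map Polynomial.C =
      U.map Polynomial.C * (M.map Polynomial.C - (Polynomial.X : A[X]) • N.map Polynomial.C) *
        V.map Polynomial.C := by
    rw [Matrix.map_mul, Matrix.map_mul, Matrix.map_mul, Matrix.map_mul, Matrix.mul_sub,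
      Matrix.sub_mul, Matrix.mul_smul, Matrix.smul_mul]
  have hU := RingHom.map_det (Polynomial.C : A →+* A[X]) U
  have hV := RingHom.map_det (Polynomial.C : A →+* A[X]) V
  rw [RingHom.mapMatrix_apply] at hU hV
  rw [detLine, h, Matrix.det_mul, Matrix.det_mul, map_mul, hU, hV, detLine]
  ring

theorem natDegree_detLine_diagonal_le [DecidableEq A] (M : Matrix P P A) (l : P → A) :
    (detLine M (Matrix.diagonal l)).natDegree ≤ (Finset.univ.filter fun i => l i ≠ 0).card := by
  rw [detLine, Matrix.det_apply']
  refine Polynomial.natDegree_sum_le_of_forall_le _ _ fun σ _ => ?_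
  rw [← Polynomial.C_eq_intCast]
  refine (Polynomial.natDegree_C_mul_le _ _).trans ((Polynomial.natDegree_prod_le _ _).trans ?_)
  rw [Finset.card_filter]
  refine Finset.sum_le_sum fun i _ => ?_
  rw [Matrix.sub_apply, Matrix.smul_apply, Matrix.map_apply, Matrix.map_apply, smul_eq_mul]
  refine (Polynomial.natDegree_sub_le _ _).trans (max_le (by simp) ?_)
  by_cases h : l i = 0
  · by_cases h' : σ i = i <;> simp [h, h']
  · rw [if_pos h]
    refine Polynomial.natDegree_mul_le.trans ?_
    rw [Polynomial.natDegree_C, add_zero]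
    exact Polynomial.natDegree_X_le

theorem natDegree_detLine_neg_one_diagonal {K : Type*} [Field K] [DecidableEq K] (l : P → K) :
    (detLine (-1) (Matrix.diagonal l)).natDegree =
      (Finset.univ.filter fun i => l i ≠ 0).card := by
  have h : ((-1 : Matrix P P K).map Polynomial.C -
      (Polynomial.X : K[X]) • (Matrix.diagonal l).map Polynomial.C) =
      Matrix.diagonal fun i => Polynomial.C (-l i) * Polynomial.X + Polynomial.C (-1) := by
    ext1 i j
    by_cases hij : i = j
    · subst hij; simp; ring
    · simp [hij]
  have hne : ∀ i, (Polynomial.C (-l i) * Polynomial.X + Polynomial.C (-1) : K[X]) ≠ 0 := by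
    intro i hi
    have := congrArg (Polynomial.coeff · 0) hi
    simp at this
  rw [detLine, h, Matrix.det_diagonal, Polynomial.natDegree_prod _ _ fun i _ => hne i,
    Finset.card_filter]
  refine Finset.sum_congr rfl fun i _ => ?_
  split_ifs with hi
  · exact Polynomial.natDegree_linear (neg_ne_zero.mpr hi)
  · rw [not_not] at hi
    simp [hi]

/-- The degree of `det (M - X • N)` is at most the rank of the symmetric matrix `N`, and this
bound is attained for `M = -1`. -/
theorem natDegree_detLine_le_neg_one (M : Matrix P P ℝ) {N : Matrix P P ℝ} (hN : N.IsHermitian) :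
    (detLine M N).natDegree ≤ (detLine (-1) N).natDegree ∧
      (detLine (-1) N).natDegree = (Finset.univ.filter fun i => hN.eigenvalues i ≠ 0).card := by
  classical
  set U : Matrix P P ℝ := hN.eigenvectorUnitary.1
  have hU1 : U * star U = 1 := Unitary.mul_star_self_of_mem hN.eigenvectorUnitary.2
  have hU2 : star U * U = 1 := Unitary.star_mul_self_of_mem hN.eigenvectorUnitary.2
  have hspec : N = U * Matrix.diagonal hN.eigenvalues * star U := by
    conv_lhs => rw [hN.spectral_theorem]
    rfl
  have hdet : U.det * (star U).det = 1 := by rw [← Matrix.det_mul, hU1, Matrix.det_one]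
  have key : ∀ M, detLine M N = detLine (star U * M * U) (Matrix.diagonal hN.eigenvalues) := by
    intro M
    have h := detLine_mul U (star U) (star U * M * U) (Matrix.diagonal hN.eigenvalues)
    rw [hdet, map_one, one_mul, ← hspec] at h
    rw [← h]
    congr 1
    calc M = (U * star U) * M * (U * star U) := by rw [hU1]; simp
      _ = _ := by simp only [Matrix.mul_assoc]
  have hneg : star U * (-1) * U = -1 := by rw [mul_neg, mul_one, neg_mul, hU2]
  have h1 : (detLine (-1) N).natDegree =
      (Finset.univ.filter fun i => hN.eigenvalues i ≠ 0).card := by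
    rw [key, hneg, natDegree_detLine_neg_one_diagonal]
  refine ⟨?_, h1⟩
  rw [h1, key]
  exact natDegree_detLine_diagonal_le _ _

/-- If all `det (R - x - X • c • N)` have degree at most `d`, so does `det (-1 - X • N)`, as a
limit of `det (s • R - 1 - X • N)`. -/
theorem natDegree_detLine_neg_one_le {R N : Matrix P P ℝ} {d : ℕ}
    (h : ∀ x c : ℝ, (detLine (R - x • 1) (c • N)).natDegree ≤ d) :
    (detLine (-1) N).natDegree ≤ d := by
  set Q : ℝ[X][X] := detLine ((Polynomial.X : ℝ[X]) • R.map Polynomial.C - 1)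
    (N.map Polynomial.C) with hQ
  have hmap : ∀ s : ℝ, Q.map (Polynomial.evalRingHom s) = detLine (s • R - 1) N := by
    intro s
    rw [hQ, map_detLine]
    congr 1
    · ext1 i j
      by_cases hij : i = j
      · subst hij; simp [Matrix.sub_apply]; ring
      · simp [Matrix.sub_apply, hij]; ring
    · ext1 i j
      simp
  have hdeg : ∀ s : ℝ, s ≠ 0 → (detLine (s • R - 1) N).natDegree ≤ d := by
    intro s hs
    have h1 := detLine_mul (s • (1 : Matrix P P ℝ)) 1 (R - s⁻¹ • 1) (s⁻¹ • N)
    have h2 : s • (1 : Matrix P P ℝ) * (R - s⁻¹ • 1) * 1 = s • R - 1 := by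
      simp [smul_sub, smul_smul, hs]
    have h3 : s • (1 : Matrix P P ℝ) * (s⁻¹ • N) * 1 = N := by
      simp [smul_smul, hs]
    rw [h2, h3] at h1
    rw [h1]
    exact (Polynomial.natDegree_C_mul_le _ _).trans (h _ _)
  have h0 : detLine (-1) N = Q.map (Polynomial.evalRingHom 0) := by
    rw [hmap, zero_smul, zero_sub]
  rw [Polynomial.natDegree_le_iff_coeff_eq_zero]
  intro n hn
  have hc : Q.coeff n = 0 := by
    refine Polynomial.eq_zero_of_infinite_isRoot _
      ((Set.finite_singleton (0 : ℝ)).infinite_compl.mono fun s hs => ?_)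
    have h4 := Polynomial.coeff_eq_zero_of_natDegree_lt ((hdeg s hs).trans_lt hn)
    rw [← hmap, Polynomial.coeff_map] at h4
    exact h4
  rw [h0, Polynomial.coeff_map, hc, map_zero]

end Pencil

/-! ### Symmetric matrices of corank two modulo a linear space -/

/-- Solvability of `A x + y + s • G x = 0` for small `s`, near a solution for `s = 0`, when the
linear part is surjective. -/
theorem eventually_exists_add_smul_eq_zero {X Y : Type*} [NormedAddCommGroup X] [NormedSpace ℝ X]
    [CompleteSpace X] [NormedAddCommGroup Y] [NormedSpace ℝ Y] [CompleteSpace Y] (A : X →L[ℝ] Y)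
    (hA : Function.Surjective A) {G : X → Y} (hG : ContDiff ℝ 1 G) {x₀ : X} {y : Y}
    (h0 : A x₀ + y = 0) {V : Set (ℝ × X)} (hV : V ∈ 𝓝 ((0 : ℝ), x₀)) :
    ∀ᶠ s : ℝ in 𝓝 0, ∃ x, (s, x) ∈ V ∧ A x + y + s • G x = 0 := by
  set Ψ : ℝ × X → ℝ × Y := fun p => (p.1, A p.2 + y + p.1 • G p.2) with hΨ
  obtain ⟨G', hG'⟩ : ∃ G' : X →L[ℝ] Y, HasStrictFDerivAt G G' x₀ :=
    ⟨_, hG.contDiffAt.hasStrictFDerivAt one_ne_zero⟩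
  have hfst : HasStrictFDerivAt (fun p : ℝ × X => p.1) (ContinuousLinearMap.fst ℝ ℝ X) (0, x₀) :=
    hasStrictFDerivAt_fst
  have hsnd : HasStrictFDerivAt (fun p : ℝ × X => p.2) (ContinuousLinearMap.snd ℝ ℝ X) (0, x₀) :=
    hasStrictFDerivAt_snd
  have hA' := (A.hasStrictFDerivAt (x := x₀)).comp ((0 : ℝ), x₀) hsnd
  have hGc := HasStrictFDerivAt.comp ((0 : ℝ), x₀) (g := G) hG' hsnd
  have hder := hfst.prodMk ((hA'.add_const y).add (hfst.smul hGc))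
  have hsurj := hder.map_nhds_eq_of_surj (by
    rw [LinearMap.range_eq_top]
    rintro ⟨σ, η⟩
    obtain ⟨ξ, hξ⟩ := hA (η - σ • G x₀)
    exact ⟨(σ, ξ), by simp [hξ]⟩)
  have himg := Filter.image_mem_map (m := Ψ) hV
  have hΨ0 : Ψ (0, x₀) = (0, 0) := by simp [hΨ, h0]
  have himg' : Ψ '' V ∈ 𝓝 ((0 : ℝ), (0 : Y)) := by
    rw [← hΨ0]
    exact hsurj ▸ himg
  have hcont : Filter.Tendsto (fun s : ℝ => (s, (0 : Y))) (𝓝 0) (𝓝 (0, 0)) :=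
    (Continuous.prodMk_left (0 : Y)).tendsto 0
  filter_upwards [hcont himg'] with s hs
  obtain ⟨⟨s', x⟩, hx, h⟩ := hs
  simp only [hΨ, Prod.mk.injEq] at h
  obtain ⟨rfl, h⟩ := h
  exact ⟨x, hx, h⟩

section Corank

variable {P ι : Type*} [Fintype P] [Fintype ι]

/-- Let `S` be symmetric with kernel spanned by `a` and `b`, and let the restrictions of the
symmetric matrices `N s` to this kernel span all quadratic forms on it.  Then every small
perturbation of `S` in a symmetric direction `T` differs by a combination of the `N s` from a matrix
of corank at least two; the kernel vectors are found in the form `a + t • u` and `b + t • v`. -/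
theorem eventually_exists_kernel_pair [DecidableEq P] {S T : Matrix P P ℝ} (hS : Sᵀ = S)
    (hT : Tᵀ = T) {N : ι → Matrix P P ℝ} (hN : ∀ s, (N s)ᵀ = N s) {a b : P → ℝ}
    (hab : LinearIndependent ℝ ![a, b]) (hSa : S *ᵥ a = 0) (hSb : S *ᵥ b = 0)
    (hrange : ∀ x, a ⬝ᵥ x = 0 → b ⬝ᵥ x = 0 → ∃ u, S *ᵥ u = x)
    (hspan : ∀ p q r : ℝ, ∃ z : ι → ℝ, a ⬝ᵥ ((∑ s, z s • N s) *ᵥ a) = p ∧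
      a ⬝ᵥ ((∑ s, z s • N s) *ᵥ b) = q ∧ b ⬝ᵥ ((∑ s, z s • N s) *ᵥ b) = r) :
    ∀ᶠ t : ℝ in 𝓝 0, t ≠ 0 → ∃ (z : ι → ℝ) (a' b' : P → ℝ), LinearIndependent ℝ ![a', b'] ∧
      a' ᵥ* (S + t • T - ∑ s, z s • N s) = 0 ∧ b' ᵥ* (S + t • T - ∑ s, z s • N s) = 0 := by
  set κ : (ι → ℝ) → Matrix P P ℝ := fun z => ∑ s, z s • N s with hκ
  have hκadd : ∀ z w, κ (z + w) = κ z + κ w := fun z w => by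
    simp [hκ, add_smul, Finset.sum_add_distrib]
  have hκsmul : ∀ (c : ℝ) z, κ (c • z) = c • κ z := fun c z => by
    simp [hκ, Finset.smul_sum, smul_smul]
  have hκT : ∀ z, (κ z)ᵀ = κ z := fun z => by simp [hκ, Matrix.transpose_sum, hN]
  have hsym : ∀ (M : Matrix P P ℝ), Mᵀ = M → ∀ x y, x ⬝ᵥ (M *ᵥ y) = (M *ᵥ x) ⬝ᵥ y := by
    intro M hM x y
    rw [Matrix.dotProduct_mulVec, ← Matrix.mulVec_transpose, hM]
  have haa : 0 < a ⬝ᵥ a := by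
    have : a ≠ 0 := by simpa using hab.ne_zero 0
    exact lt_of_le_of_ne (Finset.sum_nonneg fun i _ => mul_self_nonneg (a i))
      (Ne.symm (by simpa using this))
  -- The two kernel equations have four components along `a` and `b`, two of which agree by
  -- symmetry.  The extra unknown `l` makes the linear part surjective nevertheless.
  let A : ((P → ℝ) × (P → ℝ) × (ι → ℝ) × ℝ) →ₗ[ℝ] ((P → ℝ) × (P → ℝ)) :=
    { toFun := fun x => (S *ᵥ x.1 - κ x.2.2.1 *ᵥ a,
        S *ᵥ x.2.1 - κ x.2.2.1 *ᵥ b + x.2.2.2 • a)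
      map_add' := fun x y => by
        ext1 <;> simp only [Prod.fst_add, Prod.snd_add, Matrix.mulVec_add, hκadd,
          Matrix.add_mulVec, add_smul] <;> abel
      map_smul' := fun c x => by
        ext1 <;> simp only [Prod.smul_fst, Prod.smul_snd, Matrix.mulVec_smul, hκsmul,
          Matrix.smul_mulVec, smul_assoc, smul_sub, smul_add, RingHom.id_apply] }
  have hA : Function.Surjective A := by
    rintro ⟨p, q⟩
    set l : ℝ := (a ⬝ᵥ q - b ⬝ᵥ p) / (a ⬝ᵥ a)
    have hl' : l * (a ⬝ᵥ a) = a ⬝ᵥ q - b ⬝ᵥ p := div_mul_cancel₀ _ haa.ne'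
    obtain ⟨z, h1, h2, h3⟩ := hspan (-(a ⬝ᵥ p)) (-(b ⬝ᵥ p)) (l * (b ⬝ᵥ a) - b ⬝ᵥ q)
    change a ⬝ᵥ (κ z *ᵥ a) = _ at h1
    change a ⬝ᵥ (κ z *ᵥ b) = _ at h2
    change b ⬝ᵥ (κ z *ᵥ b) = _ at h3
    have h2' : b ⬝ᵥ (κ z *ᵥ a) = -(b ⬝ᵥ p) := by
      rw [hsym _ (hκT z), dotProduct_comm, h2]
    obtain ⟨u, hu⟩ := hrange (p + κ z *ᵥ a) (by rw [dotProduct_add, h1]; ring)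
      (by rw [dotProduct_add, h2']; ring)
    obtain ⟨v, hv⟩ := hrange (q + κ z *ᵥ b - l • a)
      (by rw [dotProduct_sub, dotProduct_add, h2, dotProduct_smul, smul_eq_mul, hl']; ring)
      (by rw [dotProduct_sub, dotProduct_add, h3, dotProduct_smul, smul_eq_mul]; ring)
    refine ⟨(u, v, z, l), ?_⟩
    ext1
    · change S *ᵥ u - κ z *ᵥ a = p
      rw [hu]; abel
    · change S *ᵥ v - κ z *ᵥ b + l • a = q
      rw [hv]; abel
  let G : ((P → ℝ) × (P → ℝ) × (ι → ℝ) × ℝ) → ((P → ℝ) × (P → ℝ)) := fun x =>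
    ((T - κ x.2.2.1) *ᵥ x.1, (T - κ x.2.2.1) *ᵥ x.2.1)
  have hG : ContDiff ℝ 1 G := by
    refine ContDiff.prodMk ?_ ?_ <;>
    · rw [contDiff_pi]
      intro i
      simp only [hκ, Matrix.mulVec, dotProduct, Matrix.sub_apply, Matrix.sum_apply,
        Matrix.smul_apply, smul_eq_mul]
      fun_prop
  obtain ⟨x₀, hx₀⟩ := hA (-(T *ᵥ a, T *ᵥ b))
  -- the vectors `a + t • u` and `b + t • v` stay independent, and `a + t • u` not orthogonal to `a`
  have hV : {p : ℝ × ((P → ℝ) × (P → ℝ) × (ι → ℝ) × ℝ) |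
      LinearIndependent ℝ ![a + p.1 • p.2.1, b + p.1 • p.2.2.1] ∧
        0 < (a + p.1 • p.2.1) ⬝ᵥ a} ∈ 𝓝 ((0 : ℝ), x₀) := by
    refine Filter.inter_mem ?_ ?_
    · have hc : Continuous fun p : ℝ × ((P → ℝ) × (P → ℝ) × (ι → ℝ) × ℝ) =>
          (![a + p.1 • p.2.1, b + p.1 • p.2.2.1] : Fin 2 → P → ℝ) := by
        refine continuous_pi fun i => ?_
        fin_cases i
        · change Continuous fun p : ℝ × ((P → ℝ) × (P → ℝ) × (ι → ℝ) × ℝ) => a + p.1 • p.2.1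
          fun_prop
        · change Continuous fun p : ℝ × ((P → ℝ) × (P → ℝ) × (ι → ℝ) × ℝ) => b + p.1 • p.2.2.1
          fun_prop
      exact (isOpen_setOfPred_linearIndependent.preimage hc).mem_nhds (by simpa using hab)
    · have hc : Continuous fun p : ℝ × ((P → ℝ) × (P → ℝ) × (ι → ℝ) × ℝ) =>
          (a + p.1 • p.2.1) ⬝ᵥ a := by
        simp only [dotProduct, Pi.add_apply, Pi.smul_apply, smul_eq_mul]
        fun_prop
      exact (isOpen_lt continuous_const hc).mem_nhds (by simpa using haa)
  filter_upwards [eventually_exists_add_smul_eq_zero (LinearMap.toContinuousLinearMap A) hA hG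
    (y := (T *ᵥ a, T *ᵥ b)) (by simp [hx₀]) hV] with t ht ht0
  obtain ⟨⟨u, v, z, l⟩, ⟨hind, hpos⟩, heq⟩ := ht
  have h1 : S *ᵥ u - κ z *ᵥ a + T *ᵥ a + t • ((T - κ z) *ᵥ u) = 0 := congrArg Prod.fst heq
  have h2 : S *ᵥ v - κ z *ᵥ b + l • a + T *ᵥ b + t • ((T - κ z) *ᵥ v) = 0 :=
    congrArg Prod.snd heq
  simp only at hind hpos
  set M := S + t • T - ∑ s, (t • z) s • N s with hM
  have hM' : M = S + t • (T - κ z) := by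
    have : ∑ s, (t • z) s • N s = t • κ z := hκsmul t z
    rw [hM, this, smul_sub]; abel
  have hMT : Mᵀ = M := by
    rw [hM', Matrix.transpose_add, Matrix.transpose_smul, Matrix.transpose_sub, hS, hT, hκT]
  have hMa : M *ᵥ (a + t • u) = 0 := by
    calc M *ᵥ (a + t • u)
        = S *ᵥ a + t • (S *ᵥ u - κ z *ᵥ a + T *ᵥ a + t • ((T - κ z) *ᵥ u)) := by
          rw [hM', Matrix.add_mulVec, Matrix.mulVec_add, Matrix.smul_mulVec, Matrix.mulVec_add,
            Matrix.mulVec_smul, Matrix.mulVec_smul, Matrix.sub_mulVec T _ a]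
          module
      _ = 0 := by rw [hSa, h1, smul_zero, add_zero]
  have hMb : M *ᵥ (b + t • v) = -(t * l) • a := by
    calc M *ᵥ (b + t • v)
        = S *ᵥ b + t • (S *ᵥ v - κ z *ᵥ b + l • a + T *ᵥ b + t • ((T - κ z) *ᵥ v)) -
            (t * l) • a := by
          rw [hM', Matrix.add_mulVec, Matrix.mulVec_add, Matrix.smul_mulVec, Matrix.mulVec_add,
            Matrix.mulVec_smul, Matrix.mulVec_smul, Matrix.sub_mulVec T _ b]
          module
      _ = _ := by rw [hSb, h2, smul_zero, add_zero, zero_sub, neg_smul]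
  -- by symmetry of `M` the correction term vanishes
  have hl : t * l = 0 := by
    have h3 := hsym M hMT (a + t • u) (b + t • v)
    rw [hMa, hMb, zero_dotProduct, dotProduct_smul, smul_eq_mul] at h3
    rcases mul_eq_zero.mp h3 with h4 | h4
    · linarith
    · exact absurd h4 hpos.ne'
  rw [hl, neg_zero, zero_smul] at hMb
  refine ⟨t • z, a + t • u, b + t • v, hind, ?_, ?_⟩
  · rw [← Matrix.mulVec_transpose, hMT, hMa]
  · rw [← Matrix.mulVec_transpose, hMT, hMb]

/-- If the symmetric matrices `N s` span all quadratic forms on a plane, the discriminant of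
`det (M - ∑ s, z s • N s)` vanishes for every symmetric `M`.  Let `S` be a symmetric matrix whose
kernel is that plane.  Close to `S`, the matrices on the line from `S` to `M` have corank at least
two modulo the `N s`, so the discriminant vanishes for them; on the line it is a polynomial
function, so it vanishes for `M` as well. -/
theorem discOfDegree_detPencil_eq_zero [DecidableEq P] {S M : Matrix P P ℝ} (hS : Sᵀ = S)
    (hM : Mᵀ = M) {N : ι → Matrix P P ℝ} (hN : ∀ s, (N s)ᵀ = N s) {a b : P → ℝ}
    (hab : LinearIndependent ℝ ![a, b]) (hSa : S *ᵥ a = 0) (hSb : S *ᵥ b = 0)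
    (hrange : ∀ x, a ⬝ᵥ x = 0 → b ⬝ᵥ x = 0 → ∃ u, S *ᵥ u = x)
    (hspan : ∀ p q r : ℝ, ∃ z : ι → ℝ, a ⬝ᵥ ((∑ s, z s • N s) *ᵥ a) = p ∧
      a ⬝ᵥ ((∑ s, z s • N s) *ᵥ b) = q ∧ b ⬝ᵥ ((∑ s, z s • N s) *ᵥ b) = r)
    {d : ℕ} (hd : 2 ≤ d) (hdeg : ∀ M : Matrix P P ℝ, (detPencil M N).totalDegree ≤ d) :
    discOfDegree d (detPencil M N) = 0 := by
  set f : MvPolynomial ι ℝ[X] := detPencil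
    (S.map Polynomial.C + (Polynomial.X : ℝ[X]) • (M - S).map Polynomial.C)
    (fun s => (N s).map Polynomial.C) with hf
  have hmap : ∀ t : ℝ, map (Polynomial.evalRingHom t) f = detPencil (S + t • (M - S)) N := by
    intro t
    rw [hf, map_detPencil]
    congr 1
    · ext i j
      simp only [Matrix.map_apply, Matrix.add_apply, Matrix.smul_apply, smul_eq_mul,
        Polynomial.coe_evalRingHom, Polynomial.eval_add, Polynomial.eval_mul, Polynomial.eval_C,
        Polynomial.eval_X]
    · ext s i j
      simp
  have heval : ∀ t : ℝ, (discOfDegree d f).eval t =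
      discOfDegree d (detPencil (S + t • (M - S)) N) := by
    intro t
    rw [← hmap, discOfDegree, discOfDegree, evalCoeffs_map, Polynomial.coe_evalRingHom]
  have hzero : discOfDegree d f = 0 := by
    have hev := eventually_exists_kernel_pair hS
      (T := M - S) (by rw [Matrix.transpose_sub, hM, hS]) hN hab hSa hSb hrange hspan
    have hroot : ∀ᶠ t : ℝ in 𝓝 0, t ≠ 0 → (discOfDegree d f).IsRoot t := by
      filter_upwards [hev] with t ht ht0
      obtain ⟨z, a', b', hind, ha', hb'⟩ := ht ht0
      rw [Polynomial.IsRoot, heval]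
      refine discOfDegree_eq_zero_of_multiple_root hd (hdeg _) z ?_
        (eval_pderiv_detPencil_eq_zero ha' hb' hind)
      rw [eval_detPencil, ← Matrix.exists_vecMul_eq_zero_iff]
      exact ⟨a', by simpa using hind.ne_zero 0, ha'⟩
    refine Polynomial.eq_zero_of_infinite_isRoot _ fun hfin => ?_
    refine infinite_of_mem_nhds (0 : ℝ) hroot ((hfin.insert 0).subset fun t ht => ?_)
    by_cases h : t = 0
    · exact Or.inl h
    · exact Or.inr (ht h)
  have h1 := heval 1
  rw [hzero, Polynomial.eval_zero, one_smul, add_sub_cancel] at h1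
  exact h1.symm

end Corank

/-! ### Matrices of 4-forms -/

section FourForms

variable {V : Type*} [NormedAddCommGroup V] [InnerProductSpace ℝ V] {n : ℕ}
  (e : OrthonormalBasis (Fin n) ℝ V)

theorem pairMatrix_transpose_of_alternating (κ : V [⋀^Fin 4]→ₗ[ℝ] ℝ) :
    (pairMatrix e κ.toMultilinearMap)ᵀ = pairMatrix e κ.toMultilinearMap := by
  ext p q
  have h := κ.map_perm ![e p.1.1, e p.1.2, e q.1.1, e q.1.2] (Equiv.swap 0 2 * Equiv.swap 1 3)
  have h1 : Equiv.Perm.sign (Equiv.swap 0 2 * Equiv.swap 1 3 : Equiv.Perm (Fin 4)) = 1 := by decide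
  have h2 : (![e p.1.1, e p.1.2, e q.1.1, e q.1.2] : Fin 4 → V) ∘
      (Equiv.swap 0 2 * Equiv.swap 1 3 : Equiv.Perm (Fin 4)) =
      ![e q.1.1, e q.1.2, e p.1.1, e p.1.2] := by
    funext i
    fin_cases i <;> rfl
  rw [h1, h2, one_smul] at h
  exact h

theorem pairMatrix_transpose_of_isCurvatureOperator
    {R : MultilinearMap ℝ (fun _ : Fin 4 => V) ℝ} (hR : IsCurvatureOperator R) :
    (pairMatrix e R)ᵀ = pairMatrix e R := by
  ext p q
  exact hR.pair_symm _ _ _ _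

theorem trace_pairMatrix_eq_zero (κ : V [⋀^Fin 4]→ₗ[ℝ] ℝ) :
    (pairMatrix e κ.toMultilinearMap).trace = 0 :=
  Finset.sum_eq_zero fun p _ =>
    κ.map_eq_zero_of_eq ![e p.1.1, e p.1.2, e p.1.1, e p.1.2] (i := 0) (j := 2) rfl (by decide)

theorem sum_smul_pairMatrix {ι : Type*} [Fintype ι] (K : ι → V [⋀^Fin 4]→ₗ[ℝ] ℝ) (z : ι → ℝ) :
    ∑ s, z s • pairMatrix e (K s).toMultilinearMap =
      pairMatrix e (∑ s, z s • K s).toMultilinearMap := by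
  ext p q
  have h : ∀ v : Fin 4 → V, (∑ s, z s • K s) v = ∑ s, z s * K s v := fun v =>
    map_sum ({ toFun := fun κ => κ v, map_zero' := rfl, map_add' := fun _ _ => rfl } :
      V [⋀^Fin 4]→ₗ[ℝ] ℝ →+ ℝ) _ _
  rw [Matrix.sum_apply]
  exact (h _).symm

/-- The coordinate 4-form of four basis vectors. -/
noncomputable def coordForm (J : Fin 4 → Fin n) : V [⋀^Fin 4]→ₗ[ℝ] ℝ :=
  Matrix.detRowAlternating.compLinearMap (LinearMap.pi fun k => e.toBasis.coord (J k))

theorem coordForm_apply (J J' : Fin 4 → Fin n) :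
    coordForm e J (e ∘ J') = (Matrix.of fun i k => if J' i = J k then (1 : ℝ) else 0).det := by
  change (Matrix.of fun i k => e.toBasis.coord (J k) (e (J' i)) : Matrix (Fin 4) (Fin 4) ℝ).det = _
  congr 1
  ext i k
  have h : e.toBasis.repr (e (J' i)) = Finsupp.single (J' i) 1 := by
    rw [← e.coe_toBasis, Module.Basis.repr_self]
  change e.toBasis.repr (e (J' i)) (J k) = _
  rw [h, Finsupp.single_apply]
  rfl

theorem coordForm_self {J : Fin 4 → Fin n} (hJ : Function.Injective J) :
    coordForm e J (e ∘ J) = 1 := by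
  rw [coordForm_apply]
  convert Matrix.det_one (n := Fin 4) (R := ℝ)
  ext i k
  simp [Matrix.one_apply, hJ.eq_iff]

theorem coordForm_of_notMem_range {J J' : Fin 4 → Fin n} {i : Fin 4} (h : ∀ k, J' i ≠ J k) :
    coordForm e J (e ∘ J') = 0 := by
  rw [coordForm_apply]
  exact Matrix.det_eq_zero_of_row_eq_zero i fun k => by simp [h k]

theorem dotProduct_mulVec_single_add_single {P : Type*} [Fintype P] [DecidableEq P]
    (N : Matrix P P ℝ) (p q r s : P) :
    (Pi.single p 1 + Pi.single q 1) ⬝ᵥ (N *ᵥ (Pi.single r 1 + Pi.single s 1)) =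
      N p r + N p s + (N q r + N q s) := by
  simp [Matrix.mulVec_add, add_dotProduct, Matrix.col]
  ring

/-- The first of two 2-forms in five variables, `e₀ ∧ e₁ + e₂ ∧ e₃`. -/
noncomputable def firstTwoForm (hn : 5 ≤ n) : PairIdx n → ℝ :=
  Pi.single ⟨(Fin.castLE hn 0, Fin.castLE hn 1), by simp [Fin.lt_def]⟩ 1 +
    Pi.single ⟨(Fin.castLE hn 2, Fin.castLE hn 3), by simp [Fin.lt_def]⟩ 1

/-- The second of two 2-forms in five variables, `e₀ ∧ e₄ + e₁ ∧ e₂`. -/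
noncomputable def secondTwoForm (hn : 5 ≤ n) : PairIdx n → ℝ :=
  Pi.single ⟨(Fin.castLE hn 0, Fin.castLE hn 4), by simp [Fin.lt_def]⟩ 1 +
    Pi.single ⟨(Fin.castLE hn 1, Fin.castLE hn 2), by simp [Fin.lt_def]⟩ 1

theorem firstTwoForm_dotProduct_self (hn : 5 ≤ n) :
    firstTwoForm hn ⬝ᵥ firstTwoForm hn = 2 := by
  simp [firstTwoForm, dotProduct_add]
  norm_num

theorem secondTwoForm_dotProduct_self (hn : 5 ≤ n) :
    secondTwoForm hn ⬝ᵥ secondTwoForm hn = 2 := by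
  simp [secondTwoForm, dotProduct_add]
  norm_num

theorem firstTwoForm_dotProduct_secondTwoForm (hn : 5 ≤ n) :
    firstTwoForm hn ⬝ᵥ secondTwoForm hn = 0 := by
  simp [firstTwoForm, secondTwoForm, dotProduct_add]

/-- The exterior products `α ∧ α`, `α ∧ β` and `β ∧ β` of the two 2-forms are linearly independent,
so 4-forms induce all quadratic forms on their span.  This is where `5 ≤ n` enters: in dimension
four all 4-forms are proportional. -/
theorem exists_fourForm_of_values (hn : 5 ≤ n) (p q r : ℝ) : ∃ κ : V [⋀^Fin 4]→ₗ[ℝ] ℝ,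
    firstTwoForm hn ⬝ᵥ (pairMatrix e κ.toMultilinearMap *ᵥ firstTwoForm hn) = p ∧
    firstTwoForm hn ⬝ᵥ (pairMatrix e κ.toMultilinearMap *ᵥ secondTwoForm hn) = q ∧
    secondTwoForm hn ⬝ᵥ (pairMatrix e κ.toMultilinearMap *ᵥ secondTwoForm hn) = r := by
  set c : Fin 5 → Fin n := Fin.castLE hn with hc
  have hcinj : Function.Injective c := Fin.castLE_injective hn
  set J₁ : Fin 4 → Fin 5 := ![0, 1, 2, 3]
  set J₂ : Fin 4 → Fin 5 := ![2, 3, 0, 4]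
  set J₃ : Fin 4 → Fin 5 := ![0, 4, 1, 2]
  set κ : V [⋀^Fin 4]→ₗ[ℝ] ℝ := (p / 2) • coordForm e (c ∘ J₁) + q • coordForm e (c ∘ J₂) +
    (r / 2) • coordForm e (c ∘ J₃) with hκ
  have hoff : ∀ {J J' : Fin 4 → Fin 5} (i : Fin 4), (∀ k, J' i ≠ J k) →
      coordForm e (c ∘ J) (e ∘ (c ∘ J')) = 0 := fun i h =>
    coordForm_of_notMem_range e (i := i) fun k hk => h k (hcinj hk)
  have happly : ∀ v, κ v = p / 2 * coordForm e (c ∘ J₁) v + q * coordForm e (c ∘ J₂) v +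
    r / 2 * coordForm e (c ∘ J₃) v := fun v => rfl
  have h₁ : κ (e ∘ (c ∘ J₁)) = p / 2 := by
    rw [happly, coordForm_self e (hcinj.comp (by decide)), hoff 1 (by decide), hoff 3 (by decide)]
    ring
  have h₂ : κ (e ∘ (c ∘ J₂)) = q := by
    rw [happly, hoff 3 (by decide), coordForm_self e (hcinj.comp (by decide)), hoff 1 (by decide)]
    ring
  have h₃ : κ (e ∘ (c ∘ J₃)) = r / 2 := by
    rw [happly, hoff 1 (by decide), hoff 2 (by decide), coordForm_self e (hcinj.comp (by decide))]
    ring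
  have hval : ∀ i j k l : Fin 5, ∀ h h', pairMatrix e κ.toMultilinearMap ⟨(c i, c j), h⟩
      ⟨(c k, c l), h'⟩ = κ (e ∘ (c ∘ ![i, j, k, l])) := by
    intro i j k l h h'
    change κ _ = κ _
    congr 1
    funext m
    fin_cases m <;> rfl
  have hzero : ∀ (J : Fin 4 → Fin 5) (i j : Fin 4), J i = J j → i ≠ j → κ (e ∘ (c ∘ J)) = 0 :=
    fun J i j h hij => κ.map_eq_zero_of_eq _ (by simp [h]) hij
  have hswap := fun a b => congrFun (congrFun (pairMatrix_transpose_of_alternating e κ) a) b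
  simp only [Matrix.transpose_apply] at hswap
  refine ⟨κ, ?_, ?_, ?_⟩
  · rw [firstTwoForm, dotProduct_mulVec_single_add_single,
      hswap ⟨(c 0, c 1), by simp [c, Fin.lt_def]⟩ ⟨(c 2, c 3), by simp [c, Fin.lt_def]⟩]
    rw [hval, hval, hval, hzero ![0, 1, 0, 1] 0 2 rfl (by decide),
      hzero ![2, 3, 2, 3] 0 2 rfl (by decide), h₁]
    ring
  · rw [firstTwoForm, secondTwoForm, dotProduct_mulVec_single_add_single]
    rw [hval, hval, hval, hval, hzero ![0, 1, 0, 4] 0 2 rfl (by decide),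
      hzero ![0, 1, 1, 2] 1 2 rfl (by decide), hzero ![2, 3, 1, 2] 0 3 rfl (by decide), h₂]
    ring
  · rw [secondTwoForm, dotProduct_mulVec_single_add_single,
      hswap ⟨(c 0, c 4), by simp [c, Fin.lt_def]⟩ ⟨(c 1, c 2), by simp [c, Fin.lt_def]⟩]
    rw [hval, hval, hval, hzero ![0, 4, 0, 4] 0 2 rfl (by decide),
      hzero ![1, 2, 1, 2] 0 2 rfl (by decide), h₃]
    ring

end FourForms

/-! ### The discriminant of the curvature pencil -/

section Curvature

variable {V : Type*} [NormedAddCommGroup V] [InnerProductSpace ℝ V] {n : ℕ}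

/-- For a numerical value of `x` the curvature polynomial is the determinant of a real pencil. -/
theorem map_curvaturePoly {ι : Type*} [Fintype ι] (e : OrthonormalBasis (Fin n) ℝ V)
    (R : MultilinearMap ℝ (fun _ : Fin 4 => V) ℝ) (K : ι → V [⋀^Fin 4]→ₗ[ℝ] ℝ) (x : ℝ) :
    map (Polynomial.evalRingHom x) (curvaturePoly e R K) =
      detPencil (pairMatrix e R - x • 1) fun s => pairMatrix e (K s).toMultilinearMap := by
  rw [curvaturePoly, RingHom.map_det, detPencil]
  congr 1
  ext1 i j
  by_cases h : i = j
  · subst h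
    simp [Matrix.sum_apply, Matrix.sub_apply]
  · simp [Matrix.sum_apply, Matrix.sub_apply, h]

/-- A nonzero symmetric matrix of trace zero has at least two nonzero eigenvalues. -/
theorem Matrix.IsHermitian.two_le_card_eigenvalues_ne_zero {P : Type*} [Fintype P] [DecidableEq P]
    {N : Matrix P P ℝ} (hN : N.IsHermitian) (htr : N.trace = 0) (h0 : N ≠ 0) :
    2 ≤ (Finset.univ.filter fun i => hN.eigenvalues i ≠ 0).card := by
  obtain ⟨i, hi⟩ : ∃ i, hN.eigenvalues i ≠ 0 := by
    by_contra! h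
    exact h0 (hN.eigenvalues_eq_zero_iff.mp (funext h))
  obtain ⟨j, hji, hj⟩ : ∃ j, j ≠ i ∧ hN.eigenvalues j ≠ 0 := by
    by_contra! h
    rw [hN.trace_eq_sum_eigenvalues, Finset.sum_eq_single i] at htr
    · exact hi htr
    · intro j _ hj
      simpa using h j hj
    · simp
  exact Finset.one_lt_card.mpr ⟨j, by simpa using hj, i, by simpa using hi, hji⟩

end Curvature

theorem mainTheorem5 {V : Type*} [NormedAddCommGroup V] [InnerProductSpace ℝ V]
    {n : ℕ} (hn : 5 ≤ n) (e : OrthonormalBasis (Fin n) ℝ V)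
    (R : MultilinearMap ℝ (fun _ : Fin 4 => V) ℝ) (hR : IsCurvatureOperator R)
    {ι : Type*} [Fintype ι] (K : Module.Basis ι ℝ (V [⋀^Fin 4]→ₗ[ℝ] ℝ))
    (d : ℕ) (hd : (curvaturePoly e R K).totalDegree ≤ d) :
    discOfDegree d (curvaturePoly e R K) = 0 := by
  set N : ι → Matrix (PairIdx n) (PairIdx n) ℝ :=
    fun s => pairMatrix e (K s).toMultilinearMap with hN
  have hNT : ∀ s, (N s)ᵀ = N s := fun s => pairMatrix_transpose_of_alternating e _
  have hNκ : ∀ κ : V [⋀^Fin 4]→ₗ[ℝ] ℝ,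
      ∑ s, K.repr κ s • N s = pairMatrix e κ.toMultilinearMap := fun κ => by
    rw [hN, sum_smul_pairMatrix, K.sum_repr]
  have hherm : ∀ k : ι → ℝ, (∑ s, k s • N s).IsHermitian := fun k => by
    rw [hN, sum_smul_pairMatrix]
    exact pairMatrix_transpose_of_alternating e _
  -- the bound on the degree for `R - x` passes to the matrix `-1`, and from there to all matrices
  have hneg : ∀ k : ι → ℝ, (detLine (-1) (∑ s, k s • N s)).natDegree ≤ d := by
    intro k
    refine natDegree_detLine_neg_one_le (R := pairMatrix e R) fun x c => ?_
    have h1 : (detPencil (pairMatrix e R - x • 1) N).totalDegree ≤ d := by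
      rw [← map_curvaturePoly]
      exact (totalDegree_map_le _ _).trans hd
    have h2 := aeval_natDegree_le _ h1 (fun s => Polynomial.C (c * k s) * Polynomial.X)
      (n := 1) fun s => (Polynomial.natDegree_C_mul_le _ _).trans Polynomial.natDegree_X_le
    rw [aeval_line_detPencil, mul_one] at h2
    simpa only [Finset.smul_sum, smul_smul] using h2
  have hdeg : ∀ M, (detPencil M N).totalDegree ≤ d := fun M =>
    totalDegree_le_of_forall_line fun k => by
      rw [aeval_line_detPencil]
      exact (natDegree_detLine_le_neg_one M (hherm k)).1.trans (hneg k)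
  have hd2 : 2 ≤ d := by
    -- a nonzero 4-form has trace zero, hence rank at least two
    obtain ⟨κ, hκ, -⟩ := exists_fourForm_of_values e hn 1 0 0
    have h := (natDegree_detLine_le_neg_one 1 (hherm (K.repr κ))).2
    refine le_trans ?_ (h ▸ hneg (K.repr κ))
    refine (hherm _).two_le_card_eigenvalues_ne_zero ?_ ?_
    · rw [hNκ, trace_pairMatrix_eq_zero]
    · rw [hNκ]
      intro h0
      rw [h0] at hκ
      simp at hκ
  have hα := firstTwoForm_dotProduct_self hn
  have hβ := secondTwoForm_dotProduct_self hn
  have hαβ := firstTwoForm_dotProduct_secondTwoForm hn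
  set α := firstTwoForm hn
  set β := secondTwoForm hn
  have hβα : β ⬝ᵥ α = 0 := by rw [dotProduct_comm, hαβ]
  -- the orthogonal projection along the span of the two 2-forms
  set S : Matrix (PairIdx n) (PairIdx n) ℝ :=
    1 - (1 / 2 : ℝ) • Matrix.vecMulVec α α - (1 / 2 : ℝ) • Matrix.vecMulVec β β with hS
  have hSapply : ∀ x, S *ᵥ x = x - (1 / 2 * (α ⬝ᵥ x)) • α - (1 / 2 * (β ⬝ᵥ x)) • β := by
    intro x
    rw [hS, Matrix.sub_mulVec, Matrix.sub_mulVec, Matrix.one_mulVec, Matrix.smul_mulVec,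
      Matrix.smul_mulVec, Matrix.vecMulVec_mulVec, Matrix.vecMulVec_mulVec]
    simp [smul_smul]
  have hST : Sᵀ = S := by
    rw [hS]
    simp [Matrix.transpose_sub, Matrix.transpose_vecMulVec]
  have hind : LinearIndependent ℝ ![α, β] := by
    rw [LinearIndependent.pair_iff]
    intro s t hst
    have h1 := congrArg (α ⬝ᵥ ·) hst
    have h2 := congrArg (β ⬝ᵥ ·) hst
    simp only [dotProduct_add, dotProduct_smul, hα, hβ, hαβ, hβα, dotProduct_zero,
      smul_eq_mul] at h1 h2
    exact ⟨by linarith, by linarith⟩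
  refine Polynomial.funext fun x => ?_
  have hx : (discOfDegree d (curvaturePoly e R K)).eval x =
      discOfDegree d (detPencil (pairMatrix e R - x • 1) N) := by
    rw [← map_curvaturePoly, discOfDegree, discOfDegree, evalCoeffs_map,
      Polynomial.coe_evalRingHom]
  rw [hx, Polynomial.eval_zero]
  refine discOfDegree_detPencil_eq_zero hST ?_ hNT hind ?_ ?_ (fun y h1 h2 => ⟨y, ?_⟩)
    (fun p q r => ?_) hd2 hdeg
  · rw [Matrix.transpose_sub, pairMatrix_transpose_of_isCurvatureOperator e hR,
      Matrix.transpose_smul, Matrix.transpose_one]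
  · rw [hSapply, hα, hβα]
    simp
  · rw [hSapply, hβ, hαβ]
    simp
  · rw [hSapply, h1, h2]
    simp
  · obtain ⟨κ, hκ⟩ := exists_fourForm_of_values e hn p q r
    exact ⟨K.repr κ, by rw [hNκ]; exact hκ⟩
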